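/- Let $m\ge 2$ and let $$G=\langle t,x,y\mid t^{2^m}=1,\ x^2=y^2=1,\ t\text{ central},\ (x,y)=t^{2^{m-1}}\rangle$$ (a group of type $\mathcal D_1$, of order $2^{m+2}$). Then $\mathbb{Q}G$ is isomorphic, as a $\mathbb{Q}$-algebra, to a direct sum of $4m$ fields and one quaternion algebra over a field. Let $K$ be a finite field of odd order $q$. Then $KG$ is semisimple; the simple components of its Wedderburn decomposition are its minimal nonzero two-sided ideals. (i) If $m\ge 3$, then $KG$ has at least $8m-10$ simple components. It has exactly $8m-10$ if and only if $q\equiv 3\pmod 8$, or $m=3$ and $q\equiv 7\pmod 8$. In that case $KG$ is the direct sum of $8m-12$ fields and two quaternion algebras, each of which is a ring of $2\times 2$ matrices over a field. (ii) If $m=2$, then $KG$ has at least $9$ simple components. It has exactly $9$ if and only if $q\equiv 3$ or $7\pmod 8$. In that case $KG$ is the direct sum of $8$ fields and one quaternion algebra, which is a ring of $2\times 2$ matrices over a field. Here a quaternion algebra over a field $Z$ of characteristic different from $2$ means the $Z$-algebra $(a,b)_Z$ with generators $i,j$ and relations $i^2=a$, $j^2=b$, $ij=-ji$, for nonzero $a,b\in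 Z$; it may be split. All isomorphisms are of algebras over $\mathbb{Q}$, respectively $K$, and the fields are extensions of $\mathbb{Q}$, respectively $K$. -/

import Mathlib

open scoped Quaternion commutatorElement

/-- The three generators `t`, `x`, `y` of a group of type `D₁`. -/
inductive D1Gen : Type
  | t
  | x
  | y

namespace D1Gen

/-- The relators of `⟨t, x, y ∣ t ^ 2 ^ m = 1, x ^ 2 = y ^ 2 = 1, t central,
(x, y) = t ^ 2 ^ (m - 1)⟩`, for `m ≥ 1`. -/
def relators (m : ℕ) : Set (FreeGroup D1Gen) :=
  {FreeGroup.of t ^ 2 ^ m,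
   FreeGroup.of x ^ 2,
   FreeGroup.of y ^ 2,
   ⁅FreeGroup.of t, FreeGroup.of x⁆,
   ⁅FreeGroup.of t, FreeGroup.of y⁆,
   ⁅FreeGroup.of x, FreeGroup.of y⁆ * (FreeGroup.of t ^ 2 ^ (m - 1))⁻¹}

end D1Gen

/-- `G` is a group of type `D₁` with parameter `m`. -/
def IsTypeD1 (m : ℕ) (G : Type*) [Group G] : Prop :=
  Nonempty (G ≃* PresentedGroup (D1Gen.relators m))

/-- The simple components of a semisimple ring: its minimal nonzero two-sided ideals. -/
def simpleComponents (A : Type*) [Ring A] : Set (TwoSidedIdeal A) :=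
  {I | IsAtom I}

/-- The number of simple components of a semisimple ring. -/
noncomputable def numSimpleComponents (A : Type*) [Ring A] : ℕ :=
  (simpleComponents A).ncard

universe v w

/-- Over a field `K` of characteristic different from two: the `K`-algebra `A` is the direct sum
of `r` fields and `s` quaternion algebras `(a, b)` with `a, b ≠ 0`, each over a field that
extends `K`. -/
def IsSumOfFieldsAndQuaternions (K : Type v) [Field K] (A : Type w) [Ring A] [Algebra K A]
    (r s : ℕ) : Prop :=
  ∃ (F : Fin r → Type v) (_ : ∀ i, Field (F i)) (_ : ∀ i, Algebra K (F i))
    (Z : Fin s → Type v) (_ : ∀ j, Field (Z j)) (_ : ∀ j, Algebra K (Z j))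
    (a b : ∀ j, Z j),
    (∀ j, a j ≠ 0 ∧ b j ≠ 0) ∧
    Nonempty (A ≃ₐ[K] (∀ i, F i) × (∀ j, ℍ[Z j, a j, b j]))

/-- As `IsSumOfFieldsAndQuaternions`, where moreover each of the quaternion algebras is a ring of
`2 × 2` matrices over its base field. -/
def IsSumOfFieldsAndSplitQuaternions (K : Type v) [Field K] (A : Type w) [Ring A] [Algebra K A]
    (r s : ℕ) : Prop :=
  ∃ (F : Fin r → Type v) (_ : ∀ i, Field (F i)) (_ : ∀ i, Algebra K (F i))
    (Z : Fin s → Type v) (_ : ∀ j, Field (Z j)) (_ : ∀ j, Algebra K (Z j))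
    (a b : ∀ j, Z j),
    (∀ j, a j ≠ 0 ∧ b j ≠ 0) ∧
    (∀ j, Nonempty (ℍ[Z j, a j, b j] ≃ₐ[Z j] Matrix (Fin 2) (Fin 2) (Z j))) ∧
    Nonempty (A ≃ₐ[K] (∀ i, F i) × (∀ j, ℍ[Z j, a j, b j]))

/-!
# Group algebras of groups of type `D₁`

Let `n = 2 ^ (m - 1)` and let `K` be a field in which `2 ≠ 0`. The central involution `s = t ^ n`
splits `KG` into two factors. Where `s = 1`, the group becomes `C_n × C₂ × C₂` and the factor is
four copies of `K[X]/(Xⁿ - 1)`, one for each choice of signs for `x` and `y`. Where `s = -1`, the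
elements `x` and `y` anticommute and have square `1`, so the factor is the quaternion algebra
`(1, 1)` over `K[X]/(Xⁿ + 1)`. The map from `KG` to the product of these algebras is onto because
the relevant idempotents are polynomials in `t`, `x`, `y`, and it is injective because normal forms
bound the order of `G` by the dimension `8 n` of the target (`D1Model.bijective_ofGroupAlgebra`).

Both polynomials are squarefree, so by the Chinese remainder theorem the commutative part is a
product of fields, and the quaternion part a product of quaternion algebras `(1, 1)`, which are
split. As `Xⁿ - 1 = (X - 1) ∏_{j < m - 1} (X ^ 2 ^ j + 1)`, there are `4 (1 + ∑_{j < m - 1} c_j)`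
fields and `c_{m - 1}` quaternion algebras, where `c_j` is the number of irreducible factors of
`X ^ 2 ^ j + 1`, the cyclotomic polynomial of level `2 ^ (j + 1)`
(`IsTypeD1.isSumOfFieldsAndSplitQuaternions`). The two-sided ideals of a product of simple rings
then show that the number of simple components is the number of factors.

Over `ℚ` every `c_j` is `1`. Over a field with `q` elements, `c_j` is `2 ^ j` divided by the order
of `q` modulo `2 ^ (j + 1)` (`FiniteField.exists_numFactors_mul_eq`). Hence `c_0 = 1`; `c_1 = 1`
exactly if `q ≡ 3` modulo `4`; and `c_j ≥ 2` for `j ≥ 2`, with equality exactly if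
`q ^ 2 ^ (j - 2)` is not `1` modulo `2 ^ (j + 1)`. If `q ≡ 3` modulo `8` all these minima are
attained; if `q ≡ 7` modulo `8` then `c_1` and `c_2` are minimal and `c_3` is not.
-/

/-! ### Simple components of finite products of simple rings -/

section SimpleComponents

variable {ι : Type*} {R : ι → Type*} [∀ i, Ring (R i)]

/-- The two-sided ideal of a product of rings formed by the elements supported at one index. -/
def TwoSidedIdeal.piSupported (R : ι → Type*) [∀ i, Ring (R i)] (i : ι) :
    TwoSidedIdeal (∀ i, R i) :=
  .mk' {f | ∀ j, j ≠ i → f j = 0} (fun _ _ => rfl)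
    (fun {f g} hf hg j hj => by simp [hf j hj, hg j hj])
    (fun {f} hf j hj => by simp [hf j hj])
    (fun {f g} hg j hj => by simp [hg j hj])
    (fun {f g} hf j hj => by simp [hf j hj])

theorem TwoSidedIdeal.mem_piSupported {i : ι} {f : ∀ i, R i} :
    f ∈ piSupported R i ↔ ∀ j, j ≠ i → f j = 0 :=
  TwoSidedIdeal.mem_mk' ..

/-- A two-sided ideal of a product of simple rings contains the `i`-th factor as soon as one of
its elements is nonzero at `i`. -/
theorem TwoSidedIdeal.piSupported_le [∀ i, IsSimpleRing (R i)] {I : TwoSidedIdeal (∀ i, R i)}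
    {i : ι} {f : ∀ i, R i} (hf : f ∈ I) (hfi : f i ≠ 0) : piSupported R i ≤ I := by
  classical
  -- the elements of `R i` whose extension by zero lies in `I`
  let J : TwoSidedIdeal (R i) := .mk' {r | Pi.single i r ∈ I} (by simp [I.zero_mem])
    (fun {a b} ha hb => by simpa [Pi.single_add] using I.add_mem ha hb)
    (fun {a} ha => by simpa [Pi.single_neg] using I.neg_mem ha)
    (fun {a b} hb => by simpa [Pi.single_mul] using I.mul_mem_left (Pi.single i a) _ hb)
    (fun {a b} ha => by simpa [Pi.single_mul] using I.mul_mem_right _ (Pi.single i b) ha)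
  have hJ : ∀ r, r ∈ J ↔ Pi.single i r ∈ I := fun r => TwoSidedIdeal.mem_mk' ..
  have h1 : (1 : R i) ∈ J := by
    refine IsSimpleRing.one_mem_of_ne_zero_mem J hfi ((hJ _).2 ?_)
    have := I.mul_mem_left (Pi.single i 1) _ hf
    rwa [← Pi.single_mul_left, one_mul] at this
  intro g hg
  rw [mem_piSupported] at hg
  have h2 := I.mul_mem_left g _ ((hJ 1).1 h1)
  convert h2 using 1
  funext j
  by_cases hj : j = i
  · subst hj; simp
  · simp [hj, hg j hj]

theorem TwoSidedIdeal.isAtom_iff_piSupported [∀ i, IsSimpleRing (R i)]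
    {I : TwoSidedIdeal (∀ i, R i)} : IsAtom I ↔ ∃ i, piSupported R i = I := by
  classical
  have hne : ∀ i, piSupported R i ≠ ⊥ := fun i h => by
    have h1 : (Pi.single i 1 : ∀ i, R i) ∈ piSupported R i :=
      mem_piSupported.2 fun j hj => by simp [hj]
    rw [h, TwoSidedIdeal.mem_bot] at h1
    simpa using congrFun h1 i
  have hpos : ∀ J : TwoSidedIdeal (∀ i, R i), J ≠ ⊥ → ∃ f ∈ J, ∃ i, f i ≠ 0 := by
    intro J hJ
    obtain ⟨f, hf, hf0⟩ := SetLike.exists_of_lt (bot_lt_iff_ne_bot.2 hJ)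
    refine ⟨f, hf, ?_⟩
    by_contra! h
    exact hf0 ((TwoSidedIdeal.mem_bot _).2 (funext h))
  constructor
  · intro hI
    obtain ⟨f, hf, i, hi⟩ := hpos I hI.1
    exact ⟨i, (hI.le_iff.1 (piSupported_le hf hi)).resolve_left (hne i)⟩
  · rintro ⟨i, rfl⟩
    refine ⟨hne i, fun J hJ => ?_⟩
    by_contra hJ0
    obtain ⟨f, hf, j, hj⟩ := hpos J hJ0
    obtain rfl : j = i := by
      by_contra hji
      exact hj (mem_piSupported.1 (hJ.le hf) j hji)
    exact hJ.not_ge (piSupported_le hf hj)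

theorem numSimpleComponents_congr {A B : Type*} [Ring A] [Ring B] (e : A ≃+* B) :
    numSimpleComponents A = numSimpleComponents B := by
  have : simpleComponents B = e.mapTwoSidedIdeal '' simpleComponents A := by
    ext I
    constructor
    · intro hI
      exact ⟨e.mapTwoSidedIdeal.symm I, (OrderIso.isAtom_iff _ _).2 hI, by simp⟩
    · rintro ⟨J, hJ, rfl⟩
      exact (OrderIso.isAtom_iff _ _).2 hJ
  rw [numSimpleComponents, numSimpleComponents, this,
    Set.ncard_image_of_injective _ e.mapTwoSidedIdeal.injective]

theorem numSimpleComponents_pi [∀ i, IsSimpleRing (R i)] :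
    numSimpleComponents (∀ i, R i) = Nat.card ι := by
  classical
  have h : simpleComponents (∀ i, R i) = Set.range (TwoSidedIdeal.piSupported R) := by
    ext I
    exact TwoSidedIdeal.isAtom_iff_piSupported
  have hinj : Function.Injective (TwoSidedIdeal.piSupported R) := by
    intro i j hij
    by_contra hne
    have h1 : (Pi.single i 1 : ∀ i, R i) ∈ TwoSidedIdeal.piSupported R i :=
      TwoSidedIdeal.mem_piSupported.2 fun k hk => by simp [hk]
    rw [hij, TwoSidedIdeal.mem_piSupported] at h1
    simpa using h1 i hne
  rw [numSimpleComponents, h, ← Set.image_univ, Set.ncard_image_of_injective _ hinj,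
    Set.ncard_univ]

universe u

theorem numSimpleComponents_pi_prod_pi {r s : ℕ} (F : Fin r → Type u) (Q : Fin s → Type u)
    [∀ i, Ring (F i)] [∀ i, Ring (Q i)] [∀ i, IsSimpleRing (F i)] [∀ i, IsSimpleRing (Q i)] :
    numSimpleComponents ((∀ i, F i) × (∀ j, Q j)) = r + s := by
  let _ : ∀ k : Fin r ⊕ Fin s, Ring (Sum.elim F Q k) :=
    Sum.rec (fun i => inferInstanceAs (Ring (F i))) (fun j => inferInstanceAs (Ring (Q j)))
  have : ∀ k : Fin r ⊕ Fin s, IsSimpleRing (Sum.elim F Q k) :=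
    Sum.rec (fun i => inferInstanceAs (IsSimpleRing (F i)))
      (fun j => inferInstanceAs (IsSimpleRing (Q j)))
  let e : ((∀ i, F i) × (∀ j, Q j)) ≃+* ∀ k, Sum.elim F Q k :=
    { Equiv.prodPiEquivSumPi F Q with
      map_mul' := fun f g => by funext k; cases k <;> rfl
      map_add' := fun f g => by funext k; cases k <;> rfl }
  rw [numSimpleComponents_congr e, numSimpleComponents_pi]
  simp

end SimpleComponents

section Split

theorem IsSumOfFieldsAndSplitQuaternions.numSimpleComponents_eq {K : Type v} [Field K] {A : Type w}
    [Ring A] [Algebra K A] {r s : ℕ} (h : IsSumOfFieldsAndSplitQuaternions K A r s) :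
    numSimpleComponents A = r + s := by
  obtain ⟨F, _, _, Z, _, _, a, b, -, hsplit, ⟨e⟩⟩ := h
  have : ∀ j, IsSimpleRing ℍ[Z j, a j, b j] := fun j =>
    .of_ringEquiv (hsplit j).some.symm.toRingEquiv inferInstance
  rw [numSimpleComponents_congr e.toRingEquiv, numSimpleComponents_pi_prod_pi]

theorem IsSumOfFieldsAndSplitQuaternions.isSemisimpleRing {K : Type v} [Field K] {A : Type w}
    [Ring A] [Algebra K A] {r s : ℕ} (h : IsSumOfFieldsAndSplitQuaternions K A r s) :
    IsSemisimpleRing A := by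
  obtain ⟨F, _, _, Z, _, _, a, b, -, hsplit, ⟨e⟩⟩ := h
  have : ∀ j, IsSemisimpleRing ℍ[Z j, a j, b j] := fun j =>
    (hsplit j).some.symm.toRingEquiv.isSemisimpleRing
  exact e.symm.toRingEquiv.isSemisimpleRing

end Split

/-! ### The order of the presented group -/

namespace D1Gen

open PresentedGroup

variable {m : ℕ}

theorem of_t_pow : (of t : PresentedGroup (relators m)) ^ 2 ^ m = 1 :=
  one_of_mem (rels := relators m) (x := FreeGroup.of t ^ 2 ^ m) (by simp [relators])

theorem of_x_sq : (of x : PresentedGroup (relators m)) ^ 2 = 1 :=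
  one_of_mem (rels := relators m) (x := FreeGroup.of x ^ 2) (by simp [relators])

theorem of_y_sq : (of y : PresentedGroup (relators m)) ^ 2 = 1 :=
  one_of_mem (rels := relators m) (x := FreeGroup.of y ^ 2) (by simp [relators])

theorem commute_of_t_of_x : Commute (of t : PresentedGroup (relators m)) (of x) :=
  commutatorElement_eq_one_iff_commute.1 <|
    one_of_mem (rels := relators m) (x := ⁅FreeGroup.of t, FreeGroup.of x⁆) (by simp [relators])

theorem commute_of_t_of_y : Commute (of t : PresentedGroup (relators m)) (of y) :=
  commutatorElement_eq_one_iff_commute.1 <|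
    one_of_mem (rels := relators m) (x := ⁅FreeGroup.of t, FreeGroup.of y⁆) (by simp [relators])

theorem commutator_of_x_of_y :
    ⁅(of x : PresentedGroup (relators m)), (of y : PresentedGroup (relators m))⁆ =
      of t ^ 2 ^ (m - 1) :=
  mk_eq_mk_of_mul_inv_mem (rels := relators m) (x := ⁅FreeGroup.of x, FreeGroup.of y⁆)
    (y := FreeGroup.of t ^ 2 ^ (m - 1)) (by simp [relators])

theorem of_y_mul_of_x : (of y : PresentedGroup (relators m)) * of x =
    of t ^ (-(2 ^ (m - 1) : ℕ) : ℤ) * (of x * of y) := by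
  have h := commutator_of_x_of_y (m := m)
  rw [commutatorElement_def, mul_inv_eq_iff_eq_mul, mul_inv_eq_iff_eq_mul] at h
  rw [zpow_neg, zpow_natCast, h]
  group

/-- The normal forms are stable under left multiplication by the generators and their inverses. -/
theorem exists_eq_zpow_mul_pow_mul_pow (g : PresentedGroup (relators m)) :
    ∃ (a : ℤ) (b c : Bool), g = of t ^ a * of x ^ b.toNat * of y ^ c.toNat := by
  have hxi : (of x : PresentedGroup (relators m))⁻¹ = of x := by
    rw [inv_eq_iff_mul_eq_one, ← sq, of_x_sq]
  have hyi : (of y : PresentedGroup (relators m))⁻¹ = of y := by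
    rw [inv_eq_iff_mul_eq_one, ← sq, of_y_sq]
  have hx : ∀ (a : ℤ) (b c : Bool), ∃ (a' : ℤ) (b' c' : Bool),
      (of x : PresentedGroup (relators m)) * (of t ^ a * of x ^ b.toNat * of y ^ c.toNat) =
        of t ^ a' * of x ^ b'.toNat * of y ^ c'.toNat := by
    intro a b c
    refine ⟨a, !b, c, ?_⟩
    rw [← mul_assoc, ← mul_assoc, ← (commute_of_t_of_x.zpow_left a).eq, mul_assoc (of t ^ a)]
    congr 2
    cases b
    · simp
    · simpa [sq] using of_x_sq (m := m)
  have hy : ∀ (a : ℤ) (b c : Bool), ∃ (a' : ℤ) (b' c' : Bool),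
      (of y : PresentedGroup (relators m)) * (of t ^ a * of x ^ b.toNat * of y ^ c.toNat) =
        of t ^ a' * of x ^ b'.toNat * of y ^ c'.toNat := by
    intro a b c
    have hc : (of y : PresentedGroup (relators m)) * of y ^ c.toNat = of y ^ (!c).toNat := by
      cases c
      · simp
      · simpa [sq] using of_y_sq (m := m)
    cases b
    · refine ⟨a, false, !c, ?_⟩
      simp only [Bool.toNat_false, pow_zero, mul_one, ← hc]
      rw [← mul_assoc, ← (commute_of_t_of_y.zpow_left a).eq, mul_assoc]
    · refine ⟨a + (-(2 ^ (m - 1) : ℕ) : ℤ), true, !c, ?_⟩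
      simp only [Bool.toNat_true, pow_one, ← hc]
      rw [← mul_assoc, ← mul_assoc, ← (commute_of_t_of_y.zpow_left a).eq, mul_assoc (of t ^ a),
        of_y_mul_of_x, zpow_add]
      simp only [mul_assoc]
  have hg : g ∈ Subgroup.closure (Set.range (of : D1Gen → PresentedGroup (relators m))) := by
    rw [closure_range_of]; trivial
  induction hg using Subgroup.closure_induction_left with
  | one => exact ⟨0, false, false, by simp⟩
  | mul_left z hz w _ ih =>
    obtain ⟨a, b, c, rfl⟩ := ih
    obtain ⟨i, rfl⟩ := hz
    cases i
    · exact ⟨1 + a, b, c, by simp only [zpow_add, zpow_one, mul_assoc]⟩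
    · exact hx a b c
    · exact hy a b c
  | inv_mul_cancel z hz w _ ih =>
    obtain ⟨a, b, c, rfl⟩ := ih
    obtain ⟨i, rfl⟩ := hz
    cases i
    · exact ⟨-1 + a, b, c, by simp only [zpow_add, zpow_neg, zpow_one, mul_assoc]⟩
    · rw [hxi]; exact hx a b c
    · rw [hyi]; exact hy a b c

theorem surjective_normalForm : Function.Surjective fun p : Fin (2 ^ m) × Bool × Bool =>
    (of t ^ (p.1 : ℕ) * of x ^ p.2.1.toNat * of y ^ p.2.2.toNat :
      PresentedGroup (relators m)) := by
  intro g
  obtain ⟨a, b, c, rfl⟩ := exists_eq_zpow_mul_pow_mul_pow g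
  have h0 : ((2 ^ m : ℕ) : ℤ) ≠ 0 := by positivity
  have hlt := Int.emod_lt_of_pos a (b := ((2 ^ m : ℕ) : ℤ)) (by positivity)
  have hnn := Int.emod_nonneg a h0
  refine ⟨(⟨(a % ((2 ^ m : ℕ) : ℤ)).toNat, by omega⟩, b, c), ?_⟩
  have : (of t : PresentedGroup (relators m)) ^ a = of t ^ (a % ((2 ^ m : ℕ) : ℤ)).toNat := by
    rw [← zpow_natCast, Int.toNat_of_nonneg hnn]
    conv_lhs => rw [← Int.emod_add_mul_ediv a ((2 ^ m : ℕ) : ℤ), zpow_add, zpow_mul, zpow_natCast,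
      of_t_pow, one_zpow, mul_one]
  simp [this]

instance : Finite (PresentedGroup (relators m)) := .of_surjective _ surjective_normalForm

theorem card_le : Nat.card (PresentedGroup (relators m)) ≤ 4 * 2 ^ m := by
  refine (Nat.card_le_card_of_surjective _ surjective_normalForm).trans ?_
  simp
  omega

end D1Gen

/-! ### The group algebra as a product of commutative and quaternion algebras -/

open Polynomial

section GroupAlgebra

variable (K : Type*) [Field K]

/-- `K[X]/(Xⁿ - 1)` once for each pair of signs, times the quaternion algebra `(1, 1)` over
`K[X]/(Xⁿ + 1)`. -/
abbrev D1Model (n : ℕ) : Type _ :=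
  (ℤˣ × ℤˣ → AdjoinRoot (X ^ n - 1 : K[X])) ×
    ℍ[AdjoinRoot (X ^ n + 1 : K[X]), 1, 1]

namespace D1Model

variable (n : ℕ)

/-- The image of the generator `t`. -/
noncomputable def T : D1Model K n := (fun _ => AdjoinRoot.root _, ⟨AdjoinRoot.root _, 0, 0, 0⟩)

/-- The image of the generator `x`. -/
noncomputable def X : D1Model K n := (fun u => ((u.1 : ℤ) : AdjoinRoot _), ⟨0, 1, 0, 0⟩)

/-- The image of the generator `y`. -/
noncomputable def Y : D1Model K n := (fun u => ((u.2 : ℤ) : AdjoinRoot _), ⟨0, 0, 1, 0⟩)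

theorem root_pow_sub : (AdjoinRoot.root (Polynomial.X ^ n - 1 : K[X])) ^ n = 1 := by
  have := AdjoinRoot.eval₂_root (Polynomial.X ^ n - 1 : K[X])
  simpa [sub_eq_zero] using this

theorem root_pow_add : (AdjoinRoot.root (Polynomial.X ^ n + 1 : K[X])) ^ n = -1 := by
  have := AdjoinRoot.eval₂_root (Polynomial.X ^ n + 1 : K[X])
  simpa [eq_neg_iff_add_eq_zero] using this

theorem mk_re_pow {R : Type*} [CommRing R] (a : R) (k : ℕ) :
    ((⟨a, 0, 0, 0⟩ : ℍ[R, 1, 1]) ^ k) = ⟨a ^ k, 0, 0, 0⟩ := by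
  induction k with
  | zero => ext <;> simp
  | succ k ih => rw [pow_succ, ih]; ext <;> simp [pow_succ]

theorem T_pow : T K n ^ n = (1, -1) := by
  refine Prod.ext (funext fun u => ?_) ?_
  · simp [T, root_pow_sub]
  · simp only [T, Prod.pow_snd, mk_re_pow, root_pow_add]
    ext <;> simp

theorem T_pow_two_mul : T K n ^ (2 * n) = 1 := by
  rw [mul_comm, pow_mul, T_pow]
  refine Prod.ext ?_ ?_ <;> simp

theorem X_sq : X K n ^ 2 = 1 := by
  refine Prod.ext (funext fun u => ?_) ?_
  · rcases Int.units_eq_one_or u.1 with h | h <;> simp [X, h]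
  · ext <;> simp [X, sq]

theorem Y_sq : Y K n ^ 2 = 1 := by
  refine Prod.ext (funext fun u => ?_) ?_
  · rcases Int.units_eq_one_or u.2 with h | h <;> simp [Y, h]
  · ext <;> simp [Y, sq]

theorem T_mul_X : T K n * X K n = X K n * T K n := by
  refine Prod.ext (mul_comm _ _) ?_
  ext <;> simp [T, X]

theorem T_mul_Y : T K n * Y K n = Y K n * T K n := by
  refine Prod.ext (mul_comm _ _) ?_
  ext <;> simp [T, Y]

theorem X_mul_Y : X K n * Y K n = T K n ^ n * (Y K n * X K n) := by
  rw [T_pow]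
  refine Prod.ext (funext fun u => ?_) ?_
  · simp [X, Y, mul_comm]
  · ext <;> simp [X, Y]

end D1Model

variable (m : ℕ)

/-- The images of the generators in the unit group of the model. -/
noncomputable def D1Gen.toModelUnits : D1Gen → (D1Model K (2 ^ (m - 1)))ˣ
  | t => Units.ofPowEqOne (D1Model.T K _) (2 * 2 ^ (m - 1)) (D1Model.T_pow_two_mul K _)
      (by positivity)
  | x => Units.ofPowEqOne (D1Model.X K _) 2 (D1Model.X_sq K _) two_ne_zero
  | y => Units.ofPowEqOne (D1Model.Y K _) 2 (D1Model.Y_sq K _) two_ne_zero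

variable {m}

theorem D1Gen.lift_toModelUnits (hm : m ≠ 0) :
    ∀ r ∈ D1Gen.relators m, FreeGroup.lift (D1Gen.toModelUnits K m) r = 1 := by
  have h2 : 2 ^ m = 2 * 2 ^ (m - 1) := by rw [← pow_succ', Nat.sub_one_add_one hm]
  rintro r (rfl | rfl | rfl | rfl | rfl | rfl)
  · rw [map_pow, FreeGroup.lift_apply_of, h2]
    exact Units.ext (D1Model.T_pow_two_mul K _)
  · rw [map_pow, FreeGroup.lift_apply_of]
    exact Units.ext (D1Model.X_sq K _)
  · rw [map_pow, FreeGroup.lift_apply_of]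
    exact Units.ext (D1Model.Y_sq K _)
  · rw [map_commutatorElement, FreeGroup.lift_apply_of, FreeGroup.lift_apply_of,
      commutatorElement_eq_one_iff_mul_comm]
    exact Units.ext (D1Model.T_mul_X K _)
  · rw [map_commutatorElement, FreeGroup.lift_apply_of, FreeGroup.lift_apply_of,
      commutatorElement_eq_one_iff_mul_comm]
    exact Units.ext (D1Model.T_mul_Y K _)
  · rw [map_mul, map_inv, map_pow, map_commutatorElement, mul_inv_eq_one]
    simp only [FreeGroup.lift_apply_of]
    rw [commutatorElement_def, mul_inv_eq_iff_eq_mul, mul_inv_eq_iff_eq_mul, mul_assoc]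
    exact Units.ext (D1Model.X_mul_Y K _)

/-- The homomorphism from the group algebra to the model. -/
noncomputable def D1Model.ofGroupAlgebra (hm : m ≠ 0) :
    MonoidAlgebra K (PresentedGroup (D1Gen.relators m)) →ₐ[K] D1Model K (2 ^ (m - 1)) :=
  MonoidAlgebra.lift K _ _
    ((Units.coeHom _).comp (PresentedGroup.toGroup (D1Gen.lift_toModelUnits K hm)))

/-- The images of the generators generate the model: `(1 + tⁿ) / 2` separates its two factors, and
the products `(1 ± x)(1 ± y) / 4` separate the four commutative ones. -/
theorem D1Model.eq_top_of_mem {n : ℕ} (h2 : (2 : K) ≠ 0) {S : Subalgebra K (D1Model K n)}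
    (hT : T K n ∈ S) (hX : X K n ∈ S) (hY : Y K n ∈ S) : S = ⊤ := by
  have h2K : (2⁻¹ : K) * 2 = 1 := inv_mul_cancel₀ h2
  -- the idempotents cutting out the two factors of the model are `(1 + tⁿ) / 2`, `(1 - tⁿ) / 2`
  have he : ((1, 0) : D1Model K n) ∈ S := by
    have : ((1, 0) : D1Model K n) = (2⁻¹ : K) • (1 + T K n ^ n) := by
      rw [T_pow]
      refine Prod.ext ?_ ?_
      · simp only [Prod.smul_fst, Prod.fst_add, Prod.fst_one]
        rw [← two_smul K (1 : ℤˣ × ℤˣ → AdjoinRoot (Polynomial.X ^ n - 1 : K[X])), smul_smul, h2K,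
          one_smul]
      · simp
    rw [this]
    exact S.smul_mem (S.add_mem S.one_mem (S.pow_mem hT _)) _
  have he' : ((0, 1) : D1Model K n) ∈ S := by
    have : ((0, 1) : D1Model K n) = 1 - (1, 0) := by
      refine Prod.ext ?_ ?_ <;> simp
    rw [this]
    exact S.sub_mem S.one_mem he
  have hp : ∀ p : K[X], ((fun _ => AdjoinRoot.mk _ p, ⟨AdjoinRoot.mk _ p, 0, 0, 0⟩) :
      D1Model K n) ∈ S := by
    intro p
    induction p using Polynomial.induction_on' with
    | add p q hp hq =>
      convert S.add_mem hp hq using 1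
      refine Prod.ext (funext fun u => by simp) ?_
      ext <;> simp
    | monomial k a =>
      convert S.smul_mem (S.pow_mem hT k) a using 1
      refine Prod.ext (funext fun u => ?_) ?_
      · simp [T, ← C_mul_X_pow_eq_monomial, Algebra.smul_def]
      · simp only [T, Prod.smul_snd, Prod.pow_snd, mk_re_pow]
        have hc : ∀ r : AdjoinRoot (Polynomial.X ^ n + 1 : K[X]), AdjoinRoot.of _ a * r = a • r :=
          fun r => by rw [Algebra.smul_def, AdjoinRoot.algebraMap_eq]
        ext <;> simp [← C_mul_X_pow_eq_monomial, hc]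
  have hq : ∀ r : AdjoinRoot (Polynomial.X ^ n + 1 : K[X]),
      ((0, ⟨r, 0, 0, 0⟩) : D1Model K n) ∈ S := by
    intro r
    obtain ⟨p, rfl⟩ := AdjoinRoot.mk_surjective r
    convert S.mul_mem he' (hp p) using 1
    refine Prod.ext ?_ ?_
    · funext u; simp
    · simp
  have hf : ∀ (u : ℤˣ × ℤˣ) (r : AdjoinRoot (Polynomial.X ^ n - 1 : K[X])),
      ((Pi.single u r, 0) : D1Model K n) ∈ S := by
    intro u r
    obtain ⟨p, rfl⟩ := AdjoinRoot.mk_surjective r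
    have hmem := S.smul_mem (S.mul_mem (S.mul_mem he (hp p)) (S.mul_mem
      (S.add_mem S.one_mem (S.smul_mem hX ((u.1 : ℤ) : K)))
      (S.add_mem S.one_mem (S.smul_mem hY ((u.2 : ℤ) : K))))) (2⁻¹ * 2⁻¹ : K)
    convert hmem using 1
    have hhalf : AdjoinRoot.of (Polynomial.X ^ n - 1 : K[X]) 2⁻¹ * 2 = 1 := by
      rw [← map_ofNat (AdjoinRoot.of (Polynomial.X ^ n - 1 : K[X])) 2, ← map_mul, h2K, map_one]
    refine Prod.ext (funext fun v => ?_) (by simp)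
    obtain ⟨u₁, u₂⟩ := u
    obtain ⟨v₁, v₂⟩ := v
    rcases Int.units_eq_one_or u₁ with rfl | rfl <;> rcases Int.units_eq_one_or u₂ with rfl | rfl <;>
    rcases Int.units_eq_one_or v₁ with rfl | rfl <;> rcases Int.units_eq_one_or v₂ with rfl | rfl <;>
    simp [X, Y, Algebra.smul_def] <;>
    linear_combination (-AdjoinRoot.mk _ p) *
      (AdjoinRoot.of (Polynomial.X ^ n - 1 : K[X]) 2⁻¹ * 2 + 1) * hhalf
  refine eq_top_iff.2 ?_
  rintro ⟨f, q⟩ -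
  change ((f, q) : D1Model K n) ∈ S
  have hdec : ((f, q) : D1Model K n) = (∑ u, ((Pi.single u (f u), 0) : D1Model K n)) +
      ((0, ⟨q.re, 0, 0, 0⟩) + (0, ⟨q.imI, 0, 0, 0⟩) * X K n + (0, ⟨q.imJ, 0, 0, 0⟩) * Y K n +
        (0, ⟨q.imK, 0, 0, 0⟩) * (X K n * Y K n)) := by
    refine Prod.ext ?_ ?_
    · simp only [Prod.fst_add, Prod.fst_sum, Prod.fst_mul, zero_mul, add_zero]
      exact (Finset.univ_sum_single f).symm
    · simp only [Prod.snd_add, Prod.snd_sum, Prod.snd_mul, X, Y]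
      ext <;> simp
  rw [hdec]
  exact S.add_mem (S.sum_mem fun u _ => hf u _) (S.add_mem (S.add_mem (S.add_mem (hq _)
    (S.mul_mem (hq _) hX)) (S.mul_mem (hq _) hY)) (S.mul_mem (hq _) (S.mul_mem hX hY)))

theorem D1Model.surjective_ofGroupAlgebra (hm : m ≠ 0) (h2 : (2 : K) ≠ 0) :
    Function.Surjective (D1Model.ofGroupAlgebra K hm) := by
  have hgen : ∀ i, (D1Gen.toModelUnits K m i : D1Model K (2 ^ (m - 1))) ∈
      (D1Model.ofGroupAlgebra K hm).range := fun i =>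
    ⟨MonoidAlgebra.of K _ (PresentedGroup.of i), by
      simp [D1Model.ofGroupAlgebra, PresentedGroup.toGroup.of]⟩
  exact AlgHom.range_eq_top _ |>.1 <| D1Model.eq_top_of_mem K h2 (hgen .t) (hgen .x) (hgen .y)

theorem D1Model.finrank_eq {n : ℕ} (hn : n ≠ 0) :
    Module.Finite K (D1Model K n) ∧ Module.finrank K (D1Model K n) = 8 * n := by
  have hsub : (Polynomial.X ^ n - 1 : K[X]).Monic := monic_X_pow_sub_C (1 : K) hn
  have hadd : (Polynomial.X ^ n + 1 : K[X]).Monic := monic_X_pow_add_C (1 : K) hn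
  have := hsub.finite_adjoinRoot
  have := hadd.finite_adjoinRoot
  have hs : Module.finrank K (AdjoinRoot (Polynomial.X ^ n - 1 : K[X])) = n := by
    rw [(AdjoinRoot.powerBasis hsub.ne_zero).finrank, AdjoinRoot.powerBasis_dim]
    exact natDegree_X_pow_sub_C (r := (1 : K))
  have ha : Module.finrank K (AdjoinRoot (Polynomial.X ^ n + 1 : K[X])) = n := by
    rw [(AdjoinRoot.powerBasis hadd.ne_zero).finrank, AdjoinRoot.powerBasis_dim]
    exact natDegree_X_pow_add_C (r := (1 : K))
  have : Nontrivial (AdjoinRoot (Polynomial.X ^ n + 1 : K[X])) :=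
    Module.nontrivial_of_finrank_pos (R := K) (by omega)
  have hfin : Module.Finite K ℍ[AdjoinRoot (Polynomial.X ^ n + 1 : K[X]), 1, 1] :=
    .trans (AdjoinRoot (Polynomial.X ^ n + 1 : K[X])) _
  refine ⟨inferInstance, ?_⟩
  rw [Module.finrank_prod, Module.finrank_pi_fintype,
    ← Module.finrank_mul_finrank K (AdjoinRoot (Polynomial.X ^ n + 1 : K[X]))
      ℍ[AdjoinRoot (Polynomial.X ^ n + 1 : K[X]), 1, 1], QuaternionAlgebra.finrank_eq_four]
  simp [hs, ha]
  ring

/-- Injectivity is a dimension count: the group has at most `2 ^ (m + 2)` elements, which is the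
dimension of the model. -/
theorem D1Model.bijective_ofGroupAlgebra (hm : m ≠ 0) (h2 : (2 : K) ≠ 0) :
    Function.Bijective (D1Model.ofGroupAlgebra K hm) := by
  have hsurj := D1Model.surjective_ofGroupAlgebra K hm h2
  obtain ⟨hfin, hrank⟩ := D1Model.finrank_eq K (n := 2 ^ (m - 1)) (by positivity)
  have hrankG : Module.finrank K (MonoidAlgebra K (PresentedGroup (D1Gen.relators m))) =
      Nat.card (PresentedGroup (D1Gen.relators m)) := by
    rw [Module.finrank_eq_nat_card_basis (MonoidAlgebra.basis _ K)]
  have : Module.Finite K (MonoidAlgebra K (PresentedGroup (D1Gen.relators m))) := inferInstance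
  have hle := LinearMap.finrank_le_finrank_of_surjective
    (f := (D1Model.ofGroupAlgebra K hm).toLinearMap) hsurj
  have hcard := D1Gen.card_le (m := m)
  have h2m : 2 ^ m = 2 * 2 ^ (m - 1) := by rw [← pow_succ', Nat.sub_one_add_one hm]
  refine ⟨?_, hsurj⟩
  exact (LinearMap.injective_iff_surjective_of_finrank_eq_finrank
    (f := (D1Model.ofGroupAlgebra K hm).toLinearMap) (by omega)).2 hsurj

end GroupAlgebra

/-! ### Splitting into simple components -/

namespace QuaternionAlgebra

/-- The quaternion algebra `(1, 1)` is split as soon as `2` is invertible: `i` and `j` are sent to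
`!![1, 0; 0, -1]` and `!![0, 1; 1, 0]`. -/
def equivMatrixOfInvertibleTwo (R : Type*) [CommRing R] [Invertible (2 : R)] :
    ℍ[R, 1, 1] ≃ₐ[R] Matrix (Fin 2) (Fin 2) R where
  toFun q := !![q.re + q.imI, q.imJ + q.imK; q.imJ - q.imK, q.re - q.imI]
  invFun M := ⟨⅟2 * (M 0 0 + M 1 1), ⅟2 * (M 0 0 - M 1 1), ⅟2 * (M 0 1 + M 1 0),
    ⅟2 * (M 0 1 - M 1 0)⟩
  left_inv q := by
    have h : (⅟2 : R) * 2 = 1 := invOf_mul_self 2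
    ext <;> simp
    · linear_combination q.re * h
    · linear_combination q.imI * h
    · linear_combination q.imJ * h
    · linear_combination q.imK * h
  right_inv M := by
    have h : (⅟2 : R) * 2 = 1 := invOf_mul_self 2
    ext i j
    fin_cases i <;> fin_cases j <;> simp
    · linear_combination M 0 0 * h
    · linear_combination M 0 1 * h
    · linear_combination M 1 0 * h
    · linear_combination M 1 1 * h
  map_mul' p q := by
    ext i j
    fin_cases i <;> fin_cases j <;> simp [Matrix.mul_apply, Fin.sum_univ_two] <;> ring
  map_add' p q := by
    ext i j
    fin_cases i <;> fin_cases j <;> simp <;> ring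
  commutes' r := by
    rw [coe_algebraMap]
    ext i j
    fin_cases i <;> fin_cases j <;> simp [Matrix.algebraMap_matrix_apply]

/-- A decomposition of the coefficient ring induces a decomposition of the quaternion algebra
`(1, 1)`. -/
def piEquiv {K R ι : Type*} [CommRing K] [CommRing R] [Algebra K R] {S : ι → Type*}
    [∀ i, CommRing (S i)] [∀ i, Algebra K (S i)] (e : R ≃ₐ[K] ∀ i, S i) :
    ℍ[R, 1, 1] ≃ₐ[K] ∀ i, ℍ[S i, 1, 1] where
  toFun q i := ⟨e q.re i, e q.imI i, e q.imJ i, e q.imK i⟩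
  invFun f := ⟨e.symm fun i => (f i).re, e.symm fun i => (f i).imI, e.symm fun i => (f i).imJ,
    e.symm fun i => (f i).imK⟩
  left_inv q := by ext <;> simp
  right_inv f := by funext i; ext <;> simp
  map_mul' p q := by funext i; ext <;> simp
  map_add' p q := by funext i; ext <;> simp
  commutes' r := by
    funext i
    change (⟨e (algebraMap K R r) i, e 0 i, e 0 i, e 0 i⟩ : ℍ[S i, 1, 1]) =
      ⟨algebraMap K (S i) r, 0, 0, 0⟩
    simp

end QuaternionAlgebra

open UniqueFactorizationMonoid

open scoped Classical in
/-- The Chinese remainder theorem for a squarefree polynomial. -/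
theorem Polynomial.nonempty_adjoinRoot_algEquiv_pi {K : Type*} [Field K] {P : K[X]}
    (hP : Squarefree P) :
    Nonempty (AdjoinRoot P ≃ₐ[K] ∀ p : (normalizedFactors P).toFinset, AdjoinRoot (p : K[X])) := by
  have h0 : P ≠ 0 := hP.ne_zero
  have hcop : Pairwise (Function.onFun IsCoprime
      fun p : (normalizedFactors P).toFinset => (p : K[X])) := by
    intro p q hpq
    have hp := Multiset.mem_toFinset.1 p.2
    have hq := Multiset.mem_toFinset.1 q.2
    refine (irreducible_of_normalized_factor _ hp).coprime_iff_not_dvd.2 fun hdvd => hpq ?_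
    exact Subtype.ext (dvd_antisymm_of_normalize_eq (normalize_normalized_factor _ hp)
      (normalize_normalized_factor _ hq) hdvd ((irreducible_of_normalized_factor _ hp).dvd_symm
        (irreducible_of_normalized_factor _ hq) hdvd))
  have hspan : Ideal.span {P} =
      ⨅ p : (normalizedFactors P).toFinset, Ideal.span {(p : K[X])} := by
    rw [Ideal.iInf_span_singleton hcop, Ideal.span_singleton_eq_span_singleton]
    refine (prod_normalizedFactors h0).symm.trans (Associated.of_eq ?_)
    rw [Finset.prod_coe_sort _ (fun p : K[X] => p), Finset.prod_eq_multiset_prod,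
      Multiset.toFinset_val, ((squarefree_iff_nodup_normalizedFactors h0).1 hP).dedup,
      Multiset.map_id']
  have hcop' : Pairwise (Function.onFun IsCoprime
      fun p : (normalizedFactors P).toFinset => Ideal.span {(p : K[X])}) := fun p q hpq =>
    (Ideal.isCoprime_span_singleton_iff _ _).2 (hcop hpq)
  exact ⟨(Ideal.quotientEquivAlgOfEq K hspan).trans
    (AlgEquiv.ofRingEquiv (f := Ideal.quotientInfRingEquivPiQuotient _ hcop') fun _ => rfl)⟩

theorem IsSumOfFieldsAndSplitQuaternions.of_algEquiv_pi {K : Type v} [Field K]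
    (h2 : (2 : K) ≠ 0) {A : Type w} [Ring A] [Algebra K A] {ι κ : Type*} [Fintype ι] [Fintype κ]
    (F : ι → Type v) [∀ i, Field (F i)] [∀ i, Algebra K (F i)]
    (Z : κ → Type v) [∀ j, Field (Z j)] [∀ j, Algebra K (Z j)]
    (e : A ≃ₐ[K] (∀ i, F i) × (∀ j, ℍ[Z j, 1, 1])) :
    IsSumOfFieldsAndSplitQuaternions K A (Fintype.card ι) (Fintype.card κ) := by
  refine ⟨fun i => F ((Fintype.equivFin ι).symm i), inferInstance, inferInstance,
    fun j => Z ((Fintype.equivFin κ).symm j), inferInstance, inferInstance, fun _ => 1, fun _ => 1,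
    fun _ => ⟨one_ne_zero, one_ne_zero⟩, fun j => ?_, ⟨e.trans (AlgEquiv.prodCongr
      (AlgEquiv.piCongrLeft K F _).symm
      (AlgEquiv.piCongrLeft K (fun j => ℍ[Z j, 1, 1]) _).symm)⟩⟩
  have h2' : (2 : Z ((Fintype.equivFin κ).symm j)) ≠ 0 := by
    rw [← map_ofNat (algebraMap K _) 2]
    exact (_root_.map_ne_zero _).2 h2
  let _ := invertibleOfNonzero h2'
  exact ⟨QuaternionAlgebra.equivMatrixOfInvertibleTwo _⟩

open scoped Classical in
theorem isSumOfFieldsAndSplitQuaternions_of_algEquiv {K : Type v} [Field K] (h2 : (2 : K) ≠ 0)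
    {A : Type w} [Ring A] [Algebra K A] {P Q : K[X]} (hP : Squarefree P) (hQ : Squarefree Q)
    (e : A ≃ₐ[K] (ℤˣ × ℤˣ → AdjoinRoot P) × ℍ[AdjoinRoot Q, 1, 1]) :
    IsSumOfFieldsAndSplitQuaternions K A (4 * Multiset.card (normalizedFactors P))
      (Multiset.card (normalizedFactors Q)) := by
  obtain ⟨eP⟩ := nonempty_adjoinRoot_algEquiv_pi hP
  obtain ⟨eQ⟩ := nonempty_adjoinRoot_algEquiv_pi hQ
  have hcard : ∀ {P : K[X]}, Squarefree P →
      Fintype.card (normalizedFactors P).toFinset = Multiset.card (normalizedFactors P) := by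
    intro P hP
    rw [Fintype.card_coe]
    exact Multiset.toFinset_card_of_nodup
      ((squarefree_iff_nodup_normalizedFactors hP.ne_zero).1 hP)
  have hirr : ∀ {P : K[X]} (p : (normalizedFactors P).toFinset), Fact (Irreducible (p : K[X])) :=
    fun p => ⟨irreducible_of_normalized_factor _ (Multiset.mem_toFinset.1 p.2)⟩
  let eF : (ℤˣ × ℤˣ → AdjoinRoot P) ≃ₐ[K]
      ∀ k : (ℤˣ × ℤˣ) × (normalizedFactors P).toFinset, AdjoinRoot (k.2 : K[X]) :=
    { toFun := fun f k => eP (f k.1) k.2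
      invFun := fun f u => eP.symm fun p => f (u, p)
      left_inv := fun f => by simp
      right_inv := fun f => by simp
      map_mul' := fun f g => by simp only [Pi.mul_apply, map_mul]; rfl
      map_add' := fun f g => by simp only [Pi.add_apply, map_add]; rfl
      commutes' := fun r => by
        funext k
        exact congrFun (eP.commutes r) k.2 }
  have := IsSumOfFieldsAndSplitQuaternions.of_algEquiv_pi h2
    (fun k : (ℤˣ × ℤˣ) × (normalizedFactors P).toFinset => AdjoinRoot (k.2 : K[X]))
    (fun q : (normalizedFactors Q).toFinset => AdjoinRoot (q : K[X]))
    (e.trans (AlgEquiv.prodCongr eF (QuaternionAlgebra.piEquiv eQ)))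
  rwa [Fintype.card_prod, hcard hP, hcard hQ] at this

/-! ### Factorization of `X ^ 2 ^ k ± 1` -/

namespace Polynomial

theorem cyclotomic_two_pow_succ (R : Type*) [CommRing R] (k : ℕ) :
    cyclotomic (2 ^ (k + 1)) R = X ^ 2 ^ k + 1 := by
  rw [cyclotomic_prime_pow_eq_geom_sum Nat.prime_two, Finset.sum_range_succ, Finset.sum_range_one,
    pow_zero, pow_one, add_comm]

variable (K : Type*) [Field K]

open scoped Classical in
/-- The number of irreducible factors of `X ^ 2 ^ k + 1`, counted with multiplicity. -/
noncomputable def numFactors (k : ℕ) : ℕ :=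
  Multiset.card (normalizedFactors (X ^ 2 ^ k + 1 : K[X]))

variable {K} (k : ℕ)

theorem squarefree_X_pow_two_pow_sub_one (h2 : (2 : K) ≠ 0) :
    Squarefree (X ^ 2 ^ k - 1 : K[X]) :=
  (X_pow_sub_one_separable_iff.2 (by push_cast; exact pow_ne_zero _ h2)).squarefree

theorem squarefree_X_pow_two_pow_add_one (h2 : (2 : K) ≠ 0) :
    Squarefree (X ^ 2 ^ k + 1 : K[X]) := by
  refine (squarefree_X_pow_two_pow_sub_one (k + 1) h2).squarefree_of_dvd ⟨X ^ 2 ^ k - 1, ?_⟩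
  ring

open scoped Classical in
theorem card_normalizedFactors_X_pow_two_pow_sub_one :
    Multiset.card (normalizedFactors (X ^ 2 ^ k - 1 : K[X])) =
      1 + ∑ j ∈ Finset.range k, numFactors K j := by
  induction k with
  | zero =>
    have : Irreducible (X - C 1 : K[X]) := irreducible_X_sub_C 1
    rw [map_one] at this
    simp [normalizedFactors_irreducible this]
  | succ k ih =>
    have h1 : (X ^ 2 ^ k - 1 : K[X]) ≠ 0 := (monic_X_pow_sub_C (1 : K) (by positivity)).ne_zero
    have h2 : (X ^ 2 ^ k + 1 : K[X]) ≠ 0 := (monic_X_pow_add_C (1 : K) (by positivity)).ne_zero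
    have : (X ^ 2 ^ (k + 1) - 1 : K[X]) = (X ^ 2 ^ k - 1) * (X ^ 2 ^ k + 1) := by ring
    rw [this, normalizedFactors_mul h1 h2, Multiset.card_add, ih, Finset.sum_range_succ, add_assoc,
      numFactors]

theorem numFactors_eq_one_of_irreducible (h : Irreducible (X ^ 2 ^ k + 1 : K[X])) :
    numFactors K k = 1 := by
  classical
  rw [numFactors, normalizedFactors_irreducible h, Multiset.card_singleton]

theorem numFactors_rat : numFactors ℚ k = 1 := by
  apply numFactors_eq_one_of_irreducible
  rw [← cyclotomic_two_pow_succ]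
  exact cyclotomic.irreducible_rat (by positivity)

end Polynomial

/-! ### Powers of odd numbers modulo powers of two -/

theorem Nat.exists_pow_two_pow_succ_eq_of_odd {q : ℕ} (hq : Odd q) (k : ℕ) :
    ∃ a, q ^ 2 ^ (k + 1) = 1 + 2 ^ (k + 3) * a := by
  induction k with
  | zero =>
    obtain ⟨b, rfl⟩ := hq
    obtain ⟨c, hc⟩ := (Nat.even_mul_succ_self b)
    exact ⟨c, by linear_combination 4 * hc⟩
  | succ k ih =>
    obtain ⟨a, ha⟩ := ih
    exact ⟨a + 2 ^ (k + 2) * a ^ 2, by rw [pow_succ 2 (k + 1), pow_mul, ha]; ring⟩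

theorem Nat.exists_pow_two_pow_succ_eq_of_mod_eight_eq_three {q : ℕ} (hq : q % 8 = 3) (k : ℕ) :
    ∃ a, q ^ 2 ^ (k + 1) = 1 + 2 ^ (k + 3) * (2 * a + 1) := by
  induction k with
  | zero =>
    obtain ⟨b, rfl⟩ : ∃ b, q = 8 * b + 3 := ⟨q / 8, by omega⟩
    exact ⟨4 * b ^ 2 + 3 * b, by ring⟩
  | succ k ih =>
    obtain ⟨a, ha⟩ := ih
    exact ⟨a + 2 ^ (k + 1) * (2 * a + 1) ^ 2, by rw [pow_succ 2 (k + 1), pow_mul, ha]; ring⟩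

/-! ### The number of irreducible factors of `X ^ 2 ^ k + 1` over a finite field -/

namespace FiniteField

variable {K : Type*} [Field K] [Finite K]

theorem exists_odd_prime_pow_of_odd_card (hq : Odd (Nat.card K)) :
    ∃ p f : ℕ, p.Prime ∧ Odd p ∧ CharP K p ∧ Nat.card K = p ^ f := by
  have := Fintype.ofFinite K
  obtain ⟨p, hc, f, hp, hK⟩ := FiniteField.card' K
  rw [Nat.card_eq_fintype_card, hK] at hq
  refine ⟨p, f, hp, ?_, hc, by rw [Nat.card_eq_fintype_card, hK]⟩
  rwa [Nat.odd_pow_iff f.ne_zero] at hq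

theorem two_ne_zero_of_odd_card (hq : Odd (Nat.card K)) : (2 : K) ≠ 0 := by
  obtain ⟨p, f, hp, hodd, hc, -⟩ := exists_odd_prime_pow_of_odd_card hq
  rw [← Nat.cast_two, Ne, CharP.cast_eq_zero_iff K p, Nat.prime_dvd_prime_iff_eq hp Nat.prime_two]
  rintro rfl
  exact absurd hodd (by decide)

/-- Every irreducible factor of `X ^ 2 ^ k + 1`, the cyclotomic polynomial of level
`2 ^ (k + 1)`, has degree the multiplicative order of `q` modulo `2 ^ (k + 1)`. -/
theorem exists_numFactors_mul_eq (hq : Odd (Nat.card K)) (k : ℕ) :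
    ∃ d, numFactors K k * d = 2 ^ k ∧
      ∀ i, d ∣ i ↔ Nat.card K ^ i ≡ 1 [MOD 2 ^ (k + 1)] := by
  classical
  have := Fintype.ofFinite K
  obtain ⟨p, f, hp, hodd, -, hK⟩ := exists_odd_prime_pow_of_odd_card hq
  have : Fact p.Prime := ⟨hp⟩
  have hp2 : p.Coprime (2 ^ (k + 1)) := (Nat.coprime_two_right.2 hodd).pow_right _
  have hcard := normalizedFactors_cyclotomic_card (Nat.card_eq_fintype_card.symm.trans hK) hp2
  have hnum : (normalizedFactors (cyclotomic (2 ^ (k + 1)) K)).toFinset.card =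
      numFactors K k := by
    have h := squarefree_X_pow_two_pow_add_one k (two_ne_zero_of_odd_card hq)
    rw [cyclotomic_two_pow_succ, numFactors]
    convert Multiset.toFinset_card_of_nodup
      ((squarefree_iff_nodup_normalizedFactors h.ne_zero).1 h)
  have htot : (2 ^ (k + 1)).totient = 2 ^ k := by
    simp [Nat.totient_prime_pow_succ Nat.prime_two]
  refine ⟨orderOf (ZMod.unitOfCoprime _ (hp2.pow_left f)), ?_, fun i => ?_⟩
  · rw [← hnum, hcard, htot]
    refine Nat.div_mul_cancel ?_
    have := orderOf_dvd_natCard (ZMod.unitOfCoprime _ (hp2.pow_left f))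
    rwa [Nat.card_eq_fintype_card, ZMod.card_units_eq_totient, htot] at this
  · rw [orderOf_dvd_iff_pow_eq_one, Units.ext_iff, Units.val_pow_eq_pow_val,
      ZMod.coe_unitOfCoprime, ← ZMod.natCast_eq_natCast_iff, hK, Units.val_one]
    push_cast
    rfl

theorem numFactors_zero (hq : Odd (Nat.card K)) : numFactors K 0 = 1 := by
  obtain ⟨d, hd, -⟩ := exists_numFactors_mul_eq hq 0
  exact Nat.eq_one_of_mul_eq_one_right hd

theorem numFactors_pos (hq : Odd (Nat.card K)) (k : ℕ) : 0 < numFactors K k := by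
  obtain ⟨d, hd, -⟩ := exists_numFactors_mul_eq hq k
  refine Nat.pos_of_ne_zero fun h => ?_
  rw [h, zero_mul] at hd
  exact absurd hd.symm (by positivity)

theorem numFactors_one_eq_one_iff (hq : Odd (Nat.card K)) :
    numFactors K 1 = 1 ↔ Nat.card K % 4 = 3 := by
  obtain ⟨d, hd, hdvd⟩ := exists_numFactors_mul_eq hq 1
  have h1 := hdvd 1
  rw [Nat.dvd_one, pow_one, Nat.ModEq] at h1
  have hodd := Nat.odd_iff.1 hq
  norm_num at h1 hd
  constructor
  · intro h
    rw [h] at hd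
    omega
  · intro h
    have hd1 : d ≠ 1 := fun hd1 => by omega
    have hd2 : d ≤ 2 := Nat.le_of_dvd two_pos (Dvd.intro_left _ hd)
    obtain rfl : d = 2 := by
      interval_cases d <;> omega
    omega

/-- The order of `q` modulo `2 ^ (k + 3)` divides `2 ^ (k + 1)`, half the degree of
`X ^ 2 ^ (k + 2) + 1`; the number of factors is `2` when it is no smaller. -/
theorem numFactors_add_two (hq : Odd (Nat.card K)) (k : ℕ) :
    2 ≤ numFactors K (k + 2) ∧ (numFactors K (k + 2) = 2 ↔
      ¬ Nat.card K ^ 2 ^ k ≡ 1 [MOD 2 ^ (k + 3)]) := by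
  obtain ⟨d, hd, hdvd⟩ := exists_numFactors_mul_eq hq (k + 2)
  have hdk : d ∣ 2 ^ (k + 1) := by
    rw [hdvd]
    obtain ⟨a, ha⟩ := Nat.exists_pow_two_pow_succ_eq_of_odd hq k
    rw [ha]
    simp [Nat.ModEq]
  rw [← hdvd]
  obtain ⟨i, hi, rfl⟩ := (Nat.dvd_prime_pow Nat.prime_two).1 hdk
  have hc : numFactors K (k + 2) = 2 ^ (k + 2 - i) := by
    refine Nat.eq_of_mul_eq_mul_right (pow_pos two_pos i) ?_
    rw [hd, ← pow_add]
    congr 1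
    omega
  rw [hc, Nat.pow_dvd_pow_iff_le_right (by norm_num)]
  refine ⟨Nat.le_self_pow (by omega) 2, ?_⟩
  rw [Nat.pow_eq_self_iff (by norm_num)]
  omega

theorem two_le_numFactors_add_two (hq : Odd (Nat.card K)) (k : ℕ) : 2 ≤ numFactors K (k + 2) :=
  (numFactors_add_two hq k).1

theorem numFactors_two_eq_two_iff (hq : Odd (Nat.card K)) :
    numFactors K 2 = 2 ↔ Nat.card K % 8 ≠ 1 := by
  rw [(numFactors_add_two hq 0).2]
  simp [Nat.ModEq]

theorem numFactors_three_ne_two (hq : Odd (Nat.card K)) (h : Nat.card K % 8 = 7) :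
    numFactors K 3 ≠ 2 := by
  intro h3
  refine (numFactors_add_two hq 1).2.1 h3 ?_
  obtain ⟨b, hb⟩ : ∃ b, Nat.card K = 8 * b + 7 := ⟨Nat.card K / 8, by omega⟩
  rw [hb, show (8 * b + 7) ^ 2 ^ 1 = 1 + 2 ^ (1 + 3) * (4 * b ^ 2 + 7 * b + 3) by ring]
  simp [Nat.ModEq]

theorem numFactors_add_two_eq_two (hq : Nat.card K % 8 = 3) (k : ℕ) :
    numFactors K (k + 2) = 2 := by
  have hodd : Odd (Nat.card K) := Nat.odd_iff.2 (by omega)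
  cases k with
  | zero => exact (numFactors_two_eq_two_iff hodd).2 (by omega)
  | succ k =>
    rw [(numFactors_add_two hodd (k + 1)).2]
    obtain ⟨a, ha⟩ := Nat.exists_pow_two_pow_succ_eq_of_mod_eight_eq_three hq k
    intro h
    have h' := (Nat.modEq_iff_dvd' (by omega)).1 h.symm
    rw [ha, Nat.add_sub_cancel_left, show k + 1 + 3 = (k + 3) + 1 by ring, pow_succ] at h'
    have := Nat.dvd_of_mul_dvd_mul_left (by positivity) h'
    omega

end FiniteField

/-! ### Groups of type `D₁` -/

theorem IsSumOfFieldsAndSplitQuaternions.isSumOfFieldsAndQuaternions {K : Type v} [Field K]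
    {A : Type w} [Ring A] [Algebra K A] {r s : ℕ} (h : IsSumOfFieldsAndSplitQuaternions K A r s) :
    IsSumOfFieldsAndQuaternions K A r s := by
  obtain ⟨F, i₁, i₂, Z, i₃, i₄, a, b, hab, -, e⟩ := h
  exact ⟨F, i₁, i₂, Z, i₃, i₄, a, b, hab, e⟩

/-- The Wedderburn decomposition of the group algebra, with the number of components expressed by
the factorization of the polynomials `X ^ 2 ^ j + 1`. -/
theorem IsTypeD1.isSumOfFieldsAndSplitQuaternions {m : ℕ} {G : Type*} [Group G]
    (hG : IsTypeD1 m G) (hm : m ≠ 0) (K : Type v) [Field K] (h2 : (2 : K) ≠ 0) :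
    IsSumOfFieldsAndSplitQuaternions K (MonoidAlgebra K G)
      (4 * (1 + ∑ j ∈ Finset.range (m - 1), numFactors K j)) (numFactors K (m - 1)) := by
  obtain ⟨g⟩ := hG
  classical
  rw [← card_normalizedFactors_X_pow_two_pow_sub_one]
  exact isSumOfFieldsAndSplitQuaternions_of_algEquiv h2 (squarefree_X_pow_two_pow_sub_one _ h2)
    (squarefree_X_pow_two_pow_add_one _ h2) ((MonoidAlgebra.domCongr K K g).trans
      (AlgEquiv.ofBijective _ (D1Model.bijective_ofGroupAlgebra K hm h2)))

open FiniteField in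
theorem mainTheorem1 {G : Type*} [Group G] (m : ℕ) (hm : 2 ≤ m) (hG : IsTypeD1 m G) :
    IsSumOfFieldsAndQuaternions ℚ (MonoidAlgebra ℚ G) (4 * m) 1 ∧
    ∀ (K : Type*) [Field K] [Finite K], Odd (Nat.card K) →
      IsSemisimpleRing (MonoidAlgebra K G) ∧
      (m = 2 →
        9 ≤ numSimpleComponents (MonoidAlgebra K G) ∧
        (numSimpleComponents (MonoidAlgebra K G) = 9 ↔
          Nat.card K ≡ 3 [MOD 8] ∨ Nat.card K ≡ 7 [MOD 8]) ∧
        (numSimpleComponents (MonoidAlgebra K G) = 9 →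
          IsSumOfFieldsAndSplitQuaternions K (MonoidAlgebra K G) 8 1)) ∧
      (3 ≤ m →
        8 * m - 10 ≤ numSimpleComponents (MonoidAlgebra K G) ∧
        (numSimpleComponents (MonoidAlgebra K G) = 8 * m - 10 ↔
          Nat.card K ≡ 3 [MOD 8] ∨ (m = 3 ∧ Nat.card K ≡ 7 [MOD 8])) ∧
        (numSimpleComponents (MonoidAlgebra K G) = 8 * m - 10 →
          IsSumOfFieldsAndSplitQuaternions K (MonoidAlgebra K G) (8 * m - 12) 2)) := by
  have hm0 : m ≠ 0 := by omega
  refine ⟨?_, fun K _ _ hq => ?_⟩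
  · have h := (hG.isSumOfFieldsAndSplitQuaternions hm0 ℚ two_ne_zero).isSumOfFieldsAndQuaternions
    simp only [numFactors_rat, Finset.sum_const,
      Finset.card_range, smul_eq_mul, mul_one, Nat.add_sub_cancel' (by omega : 1 ≤ m)] at h
    exact h
  have h : IsSumOfFieldsAndSplitQuaternions K (MonoidAlgebra K G)
      (4 * (1 + ∑ j ∈ Finset.range (m - 1), numFactors K j)) (numFactors K (m - 1)) :=
    hG.isSumOfFieldsAndSplitQuaternions hm0 K (two_ne_zero_of_odd_card hq)
  have h0 := numFactors_zero hq
  have h1 := numFactors_one_eq_one_iff hq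
  have h1pos := numFactors_pos hq 1
  have hodd := Nat.odd_iff.1 hq
  refine ⟨h.isSemisimpleRing, ?_, ?_⟩
  · rintro rfl
    rw [h.numSimpleComponents_eq]
    simp only [Nat.add_one_sub_one, Finset.sum_range_one, h0, Nat.ModEq] at h ⊢
    refine ⟨by omega, by omega, fun h9 => ?_⟩
    rwa [show numFactors K 1 = 1 by omega] at h
  · intro hm3
    obtain ⟨p, rfl⟩ := Nat.exists_eq_add_of_le' hm3
    rw [h.numSimpleComponents_eq]
    rw [show p + 3 - 1 = p + 2 by omega, Finset.sum_range_succ', Finset.sum_range_succ', h0] at h ⊢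
    simp only [zero_add, add_assoc, Nat.reduceAdd] at h ⊢
    set S := ∑ i ∈ Finset.range p, numFactors K (i + 2) with hS
    have hp2 := two_le_numFactors_add_two hq p
    have hS2 : 2 * p ≤ S := by
      have := Finset.card_nsmul_le_sum (Finset.range p) (fun i => numFactors K (i + 2)) 2
        fun i _ => two_le_numFactors_add_two hq i
      rw [Finset.card_range, smul_eq_mul] at this
      omega
    -- each term is at least its minimum, so equality holds exactly if every term is minimal
    have hmin : 4 * (1 + (S + (numFactors K 1 + 1))) + numFactors K (p + 2) = 8 * (p + 3) - 10 ↔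
        numFactors K 1 = 1 ∧ S = 2 * p ∧ numFactors K (p + 2) = 2 := by omega
    refine ⟨by omega, ?_, fun hN => ?_⟩
    · rw [hmin]
      constructor
      · rintro ⟨hc1, hSp, hcp⟩
        have h4 := h1.1 hc1
        have h37 : Nat.card K % 8 = 3 ∨ Nat.card K % 8 = 7 := by omega
        refine h37.imp (fun h3 => h3) fun h7 => ⟨?_, h7⟩
        by_contra hp
        have h3 := numFactors_three_ne_two hq h7
        have hp1 : p ≠ 1 := by rintro rfl; exact h3 hcp
        have hlt : 2 * p < S := by
          have := Finset.sum_lt_sum (s := Finset.range p) (f := fun _ => 2)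
            (g := fun i => numFactors K (i + 2)) (fun i _ => two_le_numFactors_add_two hq i)
            ⟨1, by simp; omega, lt_of_le_of_ne (two_le_numFactors_add_two hq 1) (Ne.symm h3)⟩
          rw [Finset.sum_const, Finset.card_range, smul_eq_mul] at this
          omega
        omega
      · rintro (h3 | ⟨hp, h7⟩)
        · have h3' : Nat.card K % 8 = 3 := h3
          refine ⟨h1.2 (by omega), ?_, numFactors_add_two_eq_two h3' p⟩
          rw [hS, Finset.sum_congr rfl fun i _ => numFactors_add_two_eq_two h3' i]
          simp [mul_comm]
        · have h7' : Nat.card K % 8 = 7 := h7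
          obtain rfl : p = 0 := by omega
          exact ⟨h1.2 (by omega), by simp [hS], (numFactors_two_eq_two_iff hq).2 (by omega)⟩
    · obtain ⟨hc1, hSp, hcp⟩ := hmin.1 hN
      rw [hc1, hSp, hcp] at h
      rwa [show 8 * (p + 3) - 12 = 4 * (1 + (2 * p + (1 + 1))) by omega]
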